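/- Let $n\ge 1$ and let $A,B$ be real symmetric $2n\times 2n$ matrix functions, locally integrable on $[0,\infty)$, with $B\ge 0$. With $J=\begin{pmatrix}0&-I\\ I&0\end{pmatrix}$ consider the Hamiltonian system $$J z'(x)=\bigl(A(x)+\lambda B(x)\bigr)z(x),\qquad z=\begin{pmatrix}u\\ v\end{pmatrix},\quad x\in[0,\infty),\ \lambda\in\mathbb C .$$ Assume that $\int_0^\infty z^*Bz\,dx>0$ for every nontrivial solution $z$ (for every $\lambda$), and that the system is of limit-point type at $\infty$: for every non-real $\lambda$ there are exactly $n$ linearly independent solutions with $\int_0^\infty z^*Bz\,dx<\infty$. Let $Z_D$ and $Z_N$ be the $2n\times n$ matrix solutions with $Z_D(0)=\begin{pmatrix}0\\ I\end{pmatrix}$ and $Z_N(0)=\begin{pmatrix}-I\\ 0\end{pmatrix}$. The Dirichlet and Neumann Titchmarsh–Weyl matrices $M_D(\lambda)$, $M_N(\lambda)$ are, for non-real $\lambda$, the $n\times n$ matrices for which all columns of $Z_N+Z_DM_D(\lambda)$, respectively of $Z_D-Z_NM_N(\lambda)$, are square integrable with respect to $B$ on $[0,\infty)$. Let $M$ be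 $M_D$ or $M_N$, and suppose that $M$ extends meromorphically to a neighbourhood of $\lambda=0$ and that both $M$ and $M^{-1}$ have a pole at $\lambda=0$ (that is, at least one entry has a pole there). For $\alpha\in\mathbb C$ put $$\Psi(\lambda)=\bigl(\alpha I+M(\lambda)^{-1}\bigr)^{-1}.$$ Then, for every non-real $\alpha$ and for all but finitely many real $\alpha$, the function $\Psi$ is defined on a punctured neighbourhood of $\lambda=0$ and has a removable singularity at $\lambda=0$. Moreover, if $n=2$, this holds for every $\alpha\in\mathbb C\setminus\{0\}$. -/

import Mathlib

open MeasureTheory Filter Topology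

/-- A Hamiltonian system `J z' = (A(x) + lam B(x)) z` on `[0, ∞)`, written out as
`-v' = S₁₁ u + S₁₂ v`, `u' = S₂₁ u + S₂₂ v` for `z = (u, v)` and `S = A + lam B`.
The coefficients are real symmetric `2n × 2n` matrices, locally integrable on `[0, ∞)`, and `B`
is positive semi-definite. -/
structure HamiltonianSystem (n : ℕ) where
  A : ℝ → Matrix (Fin n ⊕ Fin n) (Fin n ⊕ Fin n) ℝ
  B : ℝ → Matrix (Fin n ⊕ Fin n) (Fin n ⊕ Fin n) ℝ
  locallyIntegrable_A : ∀ i j, LocallyIntegrableOn (fun x => A x i j) (Set.Ici 0)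
  locallyIntegrable_B : ∀ i j, LocallyIntegrableOn (fun x => B x i j) (Set.Ici 0)
  isSymm_A : ∀ x, 0 ≤ x → (A x).IsSymm
  posSemidef_B : ∀ x, 0 ≤ x → (B x).PosSemidef

namespace HamiltonianSystem

variable {n : ℕ}

/-- The coefficient matrix `S(x; lam) = A(x) + lam B(x)`. -/
noncomputable def S (H : HamiltonianSystem n) (lam : ℂ) (x : ℝ) :
    Matrix (Fin n ⊕ Fin n) (Fin n ⊕ Fin n) ℂ :=
  (H.A x).map Complex.ofReal + lam • (H.B x).map Complex.ofReal

/-- `Z` (a vector solution when `κ = Unit`, a `2n × n` matrix solution when `κ = Fin n`) solves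
`J Z' = S(x; lam) Z` on `[0, ∞)` in the sense of Carathéodory: `Z` is continuous and satisfies the
integrated equation. Here `Matrix.J` is the block matrix `[[0, -I], [I, 0]]`. -/
def IsSolution {κ : Type} (H : HamiltonianSystem n) (lam : ℂ)
    (Z : ℝ → Matrix (Fin n ⊕ Fin n) κ ℂ) : Prop :=
  ContinuousOn Z (Set.Ici 0) ∧
    ∀ x, 0 ≤ x → ∀ i k,
      (Matrix.J (Fin n) ℂ * (Z x - Z 0)) i k = ∫ t in (0 : ℝ)..x, (H.S lam t * Z t) i k

/-- The integrand `Z(x)* B(x) Z(x)`. -/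
noncomputable def density {κ : Type} (H : HamiltonianSystem n)
    (Z : ℝ → Matrix (Fin n ⊕ Fin n) κ ℂ) (x : ℝ) : Matrix κ κ ℂ :=
  (Z x).conjTranspose * (H.B x).map Complex.ofReal * Z x

/-- `Z` is square integrable with respect to `B`: `∫₀^∞ Z* B Z dx < ∞`. -/
def SquareIntegrable {κ : Type} (H : HamiltonianSystem n)
    (Z : ℝ → Matrix (Fin n ⊕ Fin n) κ ℂ) : Prop :=
  ∀ k l, IntegrableOn (fun x => H.density Z x k l) (Set.Ici 0)

/-- `B` is positive definite on solutions: `∫₀^∞ z* B z dx > 0` (possibly `∞`) for every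
nontrivial solution `z`. -/
def IsDefinite (H : HamiltonianSystem n) : Prop :=
  ∀ (lam : ℂ) (z : ℝ → Matrix (Fin n ⊕ Fin n) Unit ℂ), H.IsSolution lam z →
    (∃ x, 0 ≤ x ∧ z x ≠ 0) →
      0 < ∫⁻ x in Set.Ici (0 : ℝ), ENNReal.ofReal (H.density z x () ()).re

/-- The limit-point case at infinity: for every non-real `lam` the maximal number of linearly
independent square integrable solutions on `[0, ∞)` is exactly `n`. -/
def IsLimitPoint (H : HamiltonianSystem n) : Prop :=
  ∀ lam : ℂ, lam.im ≠ 0 →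
    IsGreatest {k : ℕ | ∃ z : Fin k → ℝ → Matrix (Fin n ⊕ Fin n) Unit ℂ,
      (∀ i, H.IsSolution lam (z i) ∧ H.SquareIntegrable (z i)) ∧
      LinearIndependent ℂ (fun i (x : Set.Ici (0 : ℝ)) => z i x)} n

/-- `Z_D = (U_D, V_D)`: the matrix solution with `U_D(0) = 0`, `V_D(0) = I`. -/
def IsDirichletSolution (H : HamiltonianSystem n) (lam : ℂ)
    (Z : ℝ → Matrix (Fin n ⊕ Fin n) (Fin n) ℂ) : Prop :=
  H.IsSolution lam Z ∧ Z 0 = Matrix.fromRows 0 1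

/-- `Z_N = (U_N, V_N)`: the matrix solution with `U_N(0) = -I`, `V_N(0) = 0`. -/
def IsNeumannSolution (H : HamiltonianSystem n) (lam : ℂ)
    (Z : ℝ → Matrix (Fin n ⊕ Fin n) (Fin n) ℂ) : Prop :=
  H.IsSolution lam Z ∧ Z 0 = Matrix.fromRows (-1) 0

/-- `M` is the Dirichlet matrix `M_D`: for non-real `lam`, the solution `Z_N + Z_D M(lam)` is square
integrable. (At real points `M` is not constrained here; near a pole it is determined there by
meromorphic continuation.) -/
def IsDirichletM (H : HamiltonianSystem n) (M : ℂ → Matrix (Fin n) (Fin n) ℂ) : Prop :=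
  ∀ lam : ℂ, lam.im ≠ 0 → ∃ ZD ZN : ℝ → Matrix (Fin n ⊕ Fin n) (Fin n) ℂ,
    H.IsDirichletSolution lam ZD ∧ H.IsNeumannSolution lam ZN ∧
      H.SquareIntegrable (fun x => ZN x + ZD x * M lam)

/-- `M` is the Neumann matrix `M_N`: for non-real `lam`, the solution `Z_D - Z_N M(lam)` is square
integrable. -/
def IsNeumannM (H : HamiltonianSystem n) (M : ℂ → Matrix (Fin n) (Fin n) ℂ) : Prop :=
  ∀ lam : ℂ, lam.im ≠ 0 → ∃ ZD ZN : ℝ → Matrix (Fin n ⊕ Fin n) (Fin n) ℂ,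
    H.IsDirichletSolution lam ZD ∧ H.IsNeumannSolution lam ZN ∧
      H.SquareIntegrable (fun x => ZD x - ZN x * M lam)

/-- A Titchmarsh-Weyl matrix of the system: `M_D` or `M_N`. -/
def IsTitchmarshWeyl (H : HamiltonianSystem n) (M : ℂ → Matrix (Fin n) (Fin n) ℂ) : Prop :=
  H.IsDirichletM M ∨ H.IsNeumannM M

end HamiltonianSystem

/-- The matrix function `F` has a pole at `w`: all entries are meromorphic at `w`, and at least one
of them has a pole there. -/
def MatrixHasPoleAt {n : ℕ} (F : ℂ → Matrix (Fin n) (Fin n) ℂ) (w : ℂ) : Prop :=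
  (∀ i j, MeromorphicAt (fun lam => F lam i j) w) ∧
    ∃ i j, meromorphicOrderAt (fun lam => F lam i j) w < 0

/-- The matrix function `F` has a removable singularity at `w`: on a punctured neighbourhood of `w`
it agrees with a function that is analytic at `w`. -/
def MatrixHasRemovableSingularityAt {n : ℕ} (F : ℂ → Matrix (Fin n) (Fin n) ℂ) (w : ℂ) : Prop :=
  ∃ G : ℂ → Matrix (Fin n) (Fin n) ℂ,
    (∀ i j, AnalyticAt ℂ (fun lam => G lam i j) w) ∧ ∀ᶠ lam in 𝓝[≠] w, F lam = G lam

/-- `Ψ = (α I + M⁻¹)⁻¹`. -/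
noncomputable def Psi {n : ℕ} (M : ℂ → Matrix (Fin n) (Fin n) ℂ) (α : ℂ) (lam : ℂ) :
    Matrix (Fin n) (Fin n) ℂ :=
  (α • (1 : Matrix (Fin n) (Fin n) ℂ) + (M lam)⁻¹)⁻¹

/-- `Ψ` is defined on a punctured neighbourhood of `0` (the two matrices that are inverted are
invertible there) and has a removable singularity at `0`. -/
def PsiRemovableAtZero {n : ℕ} (M : ℂ → Matrix (Fin n) (Fin n) ℂ) (α : ℂ) : Prop :=
  (∀ᶠ lam in 𝓝[≠] (0 : ℂ),
    IsUnit (M lam) ∧ IsUnit (α • (1 : Matrix (Fin n) (Fin n) ℂ) + (M lam)⁻¹)) ∧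
  MatrixHasRemovableSingularityAt (Psi M α) 0

/-!
The Titchmarsh–Weyl matrix `M` is, up to sign, a matrix Nevanlinna function, and the statement is a
property of the Laurent expansion of such functions at a real pole.

*Sign of the imaginary part.* Lagrange's identity says that, along a solution `z = (u, v)`, the
Hermitian form `Im (u* v)` has derivative `-(Im lam) z* B z`
(`HamiltonianSystem.IsSolution.symplecticForm_eq`). Multiplied by `Im lam` it is nonincreasing, and
at every `x` it is nonnegative on some `n`-dimensional space of solutions, its signature being
`(n, n)`. By compactness of the set of orthonormal frames there is one `n`-dimensional space of
solutions on which it is nonnegative for all `x` (`exists_common_orthonormal_frame`). These solutions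
are square integrable because their energy is bounded by the initial value of the form; in the
limit-point case they are all the square integrable solutions, so the columns of the Weyl solution
are among them, and evaluation at `0` gives `(Im lam) Im (d* M(lam) d) ≤ 0`
(`HamiltonianSystem.IsTitchmarshWeyl.im_mul_im_nonpos`).

*Laurent expansion.* Consequently `N = M⁻¹` satisfies `(Im lam) Im (c* N(lam) c) ≥ 0`. A pole of order
at least two would make the imaginary part change sign inside the upper half-plane
(`Complex.eq_zero_of_im_div_pow_nonneg`), and on the real axis `N` is Hermitian by continuity from
both sides. Hence `N(lam) = R / lam + K(lam)` with `K` analytic and `R`, `K(0)` Hermitian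
(`exists_laurent_of_nevanlinna`).

*Inversion.* Let `P` be the orthogonal projection onto `ker R`. Then
`(lam (1 - P) + P) (α + N(lam))` is analytic with value `R + P (α + K(0))` at `0`, so `Ψ` has a
removable singularity as soon as this matrix is invertible
(`exists_inv_analytic_of_det_ne_zero`). A null vector `x` satisfies `R x = 0` and
`α x* x + x* K(0) x = 0`. For non-real `α` this forces `x = 0`; the determinant is therefore a nonzero
polynomial in `α`, with finitely many real zeros. If `n = 2`, then `ker R` is a line since `N` has a
pole, and `K(0)` has vanishing form on it, since otherwise the case `α = 0` would show that
`M = (0 + M⁻¹)⁻¹` has no pole; so `α x* x = 0`, and `x = 0` whenever `α ≠ 0`.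
-/

open scoped ComplexOrder Matrix

/-! ### Products of absolutely continuous functions -/

theorem AbsolutelyContinuousOnInterval.congr {E : Type*} [PseudoMetricSpace E] {f g : ℝ → E}
    {a b : ℝ} (hf : AbsolutelyContinuousOnInterval f a b) (hfg : Set.EqOn f g (Set.uIcc a b)) :
    AbsolutelyContinuousOnInterval g a b := by
  refine Tendsto.congr' ?_ hf
  filter_upwards [mem_inf_of_right (mem_principal_self _)] with E hE
  refine Finset.sum_congr rfl fun i hi => ?_
  rw [hfg (hE.1 i hi).1, hfg (hE.1 i hi).2]

theorem IntervalIntegrable.absolutelyContinuousOnInterval_primitive {p : ℝ → ℂ} {X : ℝ}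
    (hp : IntervalIntegrable p volume 0 X) :
    AbsolutelyContinuousOnInterval (fun x => ∫ t in (0 : ℝ)..x, p t) 0 X := by
  have hc : ∀ c : ℂ, AbsolutelyContinuousOnInterval (fun _ : ℝ => c) 0 X := fun c =>
    ((LipschitzWith.const c).lipschitzOnWith (s := Set.uIcc 0 X)).absolutelyContinuousOnInterval
  have hre : IntervalIntegrable (fun x => (p x).re) volume 0 X := ⟨hp.1.re, hp.2.re⟩
  have him : IntervalIntegrable (fun x => (p x).im) volume 0 X := ⟨hp.1.im, hp.2.im⟩
  have h1 := hre.absolutelyContinuousOnInterval_intervalIntegral (c := 0) (by simp)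
  have h2 := him.absolutelyContinuousOnInterval_intervalIntegral (c := 0) (by simp)
  have h3 := (h1.smul (hc 1)).add (h2.smul (hc Complex.I))
  refine h3.congr fun x hx => ?_
  have hpx : IntervalIntegrable p volume 0 x :=
    hp.mono_set (Set.uIcc_subset_uIcc_left hx)
  have e1 : ∫ t in (0 : ℝ)..x, (p t).re = (∫ t in (0 : ℝ)..x, p t).re :=
    Complex.reCLM.intervalIntegral_comp_comm hpx
  have e2 : ∫ t in (0 : ℝ)..x, (p t).im = (∫ t in (0 : ℝ)..x, p t).im :=
    Complex.imCLM.intervalIntegral_comp_comm hpx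
  simp [e1, e2, Complex.re_add_im]

/-- Product rule for two absolutely continuous functions given as primitives. -/
theorem mul_sub_mul_eq_integral_of_primitive {f g p q : ℝ → ℂ} {X : ℝ} (hX : 0 ≤ X)
    (hp : IntervalIntegrable p volume 0 X) (hq : IntervalIntegrable q volume 0 X)
    (hf : ∀ x ∈ Set.Icc 0 X, f x = f 0 + ∫ t in (0 : ℝ)..x, p t)
    (hg : ∀ x ∈ Set.Icc 0 X, g x = g 0 + ∫ t in (0 : ℝ)..x, q t) :
    f X * g X - f 0 * g 0 = ∫ t in (0 : ℝ)..X, (p t * g t + f t * q t) := by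
  -- `f`, `g` need not be primitives outside `[0, X]`; differentiate the primitives `F`, `G` instead.
  set F : ℝ → ℂ := fun x => f 0 + ∫ t in (0 : ℝ)..x, p t with hF
  set G : ℝ → ℂ := fun x => g 0 + ∫ t in (0 : ℝ)..x, q t with hG
  have hc : ∀ c : ℂ, AbsolutelyContinuousOnInterval (fun _ : ℝ => c) 0 X := fun c =>
    ((LipschitzWith.const c).lipschitzOnWith (s := Set.uIcc 0 X)).absolutelyContinuousOnInterval
  have hFac : AbsolutelyContinuousOnInterval F 0 X :=
    (hc (f 0)).add hp.absolutelyContinuousOnInterval_primitive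
  have hGac : AbsolutelyContinuousOnInterval G 0 X :=
    (hc (g 0)).add hq.absolutelyContinuousOnInterval_primitive
  have hr : IntervalIntegrable (fun t => p t * G t + F t * q t) volume 0 X :=
    (hp.mul_continuousOn hGac.continuousOn).add (hq.continuousOn_mul hFac.continuousOn)
  have hK := (hFac.smul hGac).sub hr.absolutelyContinuousOnInterval_primitive
  obtain ⟨C, hC⟩ := hK.const_of_ae_hasDerivAt_zero (by
    filter_upwards [hp.ae_hasDerivAt_integral, hq.ae_hasDerivAt_integral,
      hr.ae_hasDerivAt_integral] with x h1 h2 h3 hx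
    have e1 := (h1 hx 0 (by simp)).const_add (f 0)
    have e2 := (h2 hx 0 (by simp)).const_add (g 0)
    have e3 := h3 hx 0 (by simp)
    have := (e1.mul e2).sub e3
    exact this.congr_deriv (sub_self (_ : ℂ)))
  have h0 := hC 0 (by simp)
  have h1 := hC X (by simp)
  have hcongr : ∫ t in (0 : ℝ)..X, (p t * g t + f t * q t)
      = ∫ t in (0 : ℝ)..X, (p t * G t + F t * q t) := by
    refine intervalIntegral.integral_congr fun t ht => ?_
    rw [Set.uIcc_of_le hX] at ht
    simp only [hf t ht, hg t ht, hF, hG]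
  rw [hcongr, hf X ⟨hX, le_rfl⟩, hg X ⟨hX, le_rfl⟩]
  have hF0 : F 0 = f 0 := by simp [hF]
  have hG0 : G 0 = g 0 := by simp [hG]
  simp [hF0, hG0] at h0 h1
  change F X * G X - f 0 * g 0 = _
  rw [← h0] at h1
  linear_combination h1

/-! ### Solutions of the Hamiltonian system and Lagrange's identity -/

namespace HamiltonianSystem
variable {n : ℕ}

theorem conjTranspose_S (H : HamiltonianSystem n) (lam : ℂ) {x : ℝ} (hx : 0 ≤ x) :
    (H.S lam x).conjTranspose = H.S (starRingEnd ℂ lam) x := by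
  have hA := H.isSymm_A x hx
  have hB := (H.posSemidef_B x hx).isHermitian
  ext i j
  have h1 : H.A x j i = H.A x i j := hA.apply i j
  have h2 : H.B x j i = H.B x i j := by simpa using hB.apply i j
  simp [S, h1, h2]

theorem locallyIntegrableOn_S (H : HamiltonianSystem n) (lam : ℂ) (i j : Fin n ⊕ Fin n) :
    LocallyIntegrableOn (fun x => H.S lam x i j) (Set.Ici 0) := by
  have h : ∀ f : ℝ → ℝ, LocallyIntegrableOn f (Set.Ici 0) →
      LocallyIntegrableOn (fun x => (f x : ℂ)) (Set.Ici 0) := fun f hf x hx => by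
    obtain ⟨s, hs, hs'⟩ := hf x hx
    exact ⟨s, hs, hs'.ofReal⟩
  exact (h _ (H.locallyIntegrable_A i j)).add ((h _ (H.locallyIntegrable_B i j)).smul lam)

theorem IsSolution.intervalIntegrable {κ : Type} {H : HamiltonianSystem n} {lam : ℂ}
    {Z : ℝ → Matrix (Fin n ⊕ Fin n) κ ℂ} (hZ : H.IsSolution lam Z) {x : ℝ} (hx : 0 ≤ x)
    (i : Fin n ⊕ Fin n) (k : κ) :
    IntervalIntegrable (fun t => (H.S lam t * Z t) i k) volume 0 x := by
  simp only [Matrix.mul_apply]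
  suffices h : ∀ j, IntervalIntegrable (fun t => H.S lam t i j * Z t j k) volume 0 x by
    simpa only [Finset.sum_fn] using IntervalIntegrable.sum Finset.univ fun j _ => h j
  intro j
  have hsub : Set.Icc 0 x ⊆ Set.Ici (0 : ℝ) := Set.Icc_subset_Ici_self
  have h1 : IntervalIntegrable (fun t => H.S lam t i j) volume 0 x := by
    rw [intervalIntegrable_iff_integrableOn_Icc_of_le hx]
    exact (H.locallyIntegrableOn_S lam i j).integrableOn_compact_subset hsub isCompact_Icc
  refine h1.mul_continuousOn ?_
  rw [Set.uIcc_of_le hx]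
  exact (continuousOn_pi.1 (continuousOn_pi.1 hZ.1 j) k).mono hsub

/-- Right multiplication by a constant matrix superposes the columns of a solution. -/
theorem IsSolution.mul_const {κ κ' : Type} [Fintype κ] {H : HamiltonianSystem n} {lam : ℂ}
    {Z : ℝ → Matrix (Fin n ⊕ Fin n) κ ℂ} (hZ : H.IsSolution lam Z) (C : Matrix κ κ' ℂ) :
    H.IsSolution lam (fun x => Z x * C) := by
  refine ⟨?_, fun x hx i k => ?_⟩
  · exact (Continuous.matrix_mul continuous_id continuous_const).comp_continuousOn hZ.1
  · have h1 : ∀ t, (H.S lam t * (Z t * C)) i k = ∑ j, (H.S lam t * Z t) i j * C j k := fun t => by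
      rw [← Matrix.mul_assoc, Matrix.mul_apply]
    simp only [h1]
    rw [intervalIntegral.integral_finsetSum
      fun j _ => (hZ.intervalIntegrable hx i j).mul_const _]
    simp only [intervalIntegral.integral_mul_const]
    rw [← Matrix.sub_mul, ← Matrix.mul_assoc, Matrix.mul_apply]
    exact Finset.sum_congr rfl fun j _ => by rw [hZ.2 x hx i j]

theorem IsSolution.fromCols {κ κ' : Type} {H : HamiltonianSystem n} {lam : ℂ}
    {Z : ℝ → Matrix (Fin n ⊕ Fin n) κ ℂ} {Z' : ℝ → Matrix (Fin n ⊕ Fin n) κ' ℂ}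
    (hZ : H.IsSolution lam Z) (hZ' : H.IsSolution lam Z') :
    H.IsSolution lam (fun x => Matrix.fromCols (Z x) (Z' x)) := by
  refine ⟨?_, fun x hx i k => ?_⟩
  · refine continuousOn_pi.2 fun i => continuousOn_pi.2 fun k => ?_
    rcases k with k | k
    · exact continuousOn_pi.1 (continuousOn_pi.1 hZ.1 i) k
    · exact continuousOn_pi.1 (continuousOn_pi.1 hZ'.1 i) k
  · rcases k with k | k
    · exact hZ.2 x hx i k
    · exact hZ'.2 x hx i k

/-- The two components of the integrated equation solved for `u` and `v`. -/
theorem IsSolution.apply_eq {κ : Type} {H : HamiltonianSystem n} {lam : ℂ}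
    {Z : ℝ → Matrix (Fin n ⊕ Fin n) κ ℂ} (hZ : H.IsSolution lam Z) {x : ℝ} (hx : 0 ≤ x)
    (j : Fin n) (k : κ) :
    Z x (.inl j) k = Z 0 (.inl j) k + ∫ t in (0 : ℝ)..x, (H.S lam t * Z t) (.inr j) k ∧
    Z x (.inr j) k = Z 0 (.inr j) k + ∫ t in (0 : ℝ)..x, -(H.S lam t * Z t) (.inl j) k := by
  have h1 := hZ.2 x hx (.inr j) k
  have h2 := hZ.2 x hx (.inl j) k
  rw [intervalIntegral.integral_neg, ← h1, ← h2]
  constructor <;>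
  simp [Matrix.J, Matrix.mul_apply, Matrix.fromBlocks, Matrix.one_apply, Matrix.neg_apply]

theorem conjTranspose_mul_J_mul_apply {κ κ' : Type} (Y : Matrix (Fin n ⊕ Fin n) κ ℂ)
    (Z : Matrix (Fin n ⊕ Fin n) κ' ℂ) (k : κ) (l : κ') :
    (Y.conjTranspose * Matrix.J (Fin n) ℂ * Z) k l =
      ∑ j, (star (Y (.inr j) k) * Z (.inl j) l - star (Y (.inl j) k) * Z (.inr j) l) := by
  rw [Matrix.mul_assoc, Matrix.mul_apply, Fintype.sum_sum_type, ← Finset.sum_add_distrib]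
  refine Finset.sum_congr rfl fun j _ => ?_
  simp [Matrix.J, Matrix.mul_apply, Matrix.fromBlocks, Matrix.one_apply, Matrix.neg_apply]
  ring

/-- Lagrange's identity: `(Z* J Z)' = (lam - conj lam) Z* B Z`, in integrated form. -/
theorem IsSolution.lagrange {κ : Type} {H : HamiltonianSystem n} {lam : ℂ}
    {Z : ℝ → Matrix (Fin n ⊕ Fin n) κ ℂ} (hZ : H.IsSolution lam Z) {X : ℝ} (hX : 0 ≤ X)
    (k l : κ) :
    ((Z X).conjTranspose * Matrix.J (Fin n) ℂ * Z X) k l -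
      ((Z 0).conjTranspose * Matrix.J (Fin n) ℂ * Z 0) k l =
      (lam - starRingEnd ℂ lam) * ∫ t in (0 : ℝ)..X, H.density Z t k l := by
  set g : Fin n ⊕ Fin n → κ → ℝ → ℂ := fun i k t => (H.S lam t * Z t) i k with hg
  have hgi : ∀ i k, IntervalIntegrable (g i k) volume 0 X := fun i k =>
    hZ.intervalIntegrable hX i k
  have hgs : ∀ i k, IntervalIntegrable (fun t => star (g i k t)) volume 0 X := fun i k =>
    ⟨Complex.conjCLE.toContinuousLinearMap.integrable_comp (hgi i k).1,
      Complex.conjCLE.toContinuousLinearMap.integrable_comp (hgi i k).2⟩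
  have hconj : ∀ (f : ℝ → ℂ) x, ∫ t in (0 : ℝ)..x, star (f t) = star (∫ t in (0 : ℝ)..x, f t) :=
    fun f x => intervalIntegral.intervalIntegral_conj
  have hcont : ∀ i k, ContinuousOn (fun t => Z t i k) (Set.uIcc 0 X) := fun i k => by
    rw [Set.uIcc_of_le hX]
    exact (continuousOn_pi.1 (continuousOn_pi.1 hZ.1 i) k).mono Set.Icc_subset_Ici_self
  have e1 : ∀ j, star (Z X (.inr j) k) * Z X (.inl j) l - star (Z 0 (.inr j) k) * Z 0 (.inl j) l =
      ∫ t in (0 : ℝ)..X, (-star (g (.inl j) k t) * Z t (.inl j) l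
        + star (Z t (.inr j) k) * g (.inr j) l t) := fun j => by
    refine mul_sub_mul_eq_integral_of_primitive (f := fun t => star (Z t (.inr j) k))
      (g := fun t => Z t (.inl j) l) hX (hgs _ _).neg (hgi _ _) (fun x hx => ?_) (fun x hx => ?_)
    · simp only [(hZ.apply_eq hx.1 j k).2, star_add, intervalIntegral.integral_neg, star_neg, hconj]
      rfl
    · exact (hZ.apply_eq hx.1 j l).1
  have e2 : ∀ j, star (Z X (.inl j) k) * Z X (.inr j) l - star (Z 0 (.inl j) k) * Z 0 (.inr j) l =
      ∫ t in (0 : ℝ)..X, (star (g (.inr j) k t) * Z t (.inr j) l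
        + star (Z t (.inl j) k) * -g (.inl j) l t) := fun j => by
    refine mul_sub_mul_eq_integral_of_primitive (f := fun t => star (Z t (.inl j) k))
      (g := fun t => Z t (.inr j) l) hX (hgs _ _) (hgi _ _).neg (fun x hx => ?_) (fun x hx => ?_)
    · simp only [(hZ.apply_eq hx.1 j k).1, star_add, hconj]
      rfl
    · exact (hZ.apply_eq hx.1 j l).2
  have hint : ∀ j, IntervalIntegrable (fun t => (-star (g (.inl j) k t) * Z t (.inl j) l
        + star (Z t (.inr j) k) * g (.inr j) l t) - (star (g (.inr j) k t) * Z t (.inr j) l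
        + star (Z t (.inl j) k) * -g (.inl j) l t)) volume 0 X := fun j =>
    (((hgs _ _).neg.mul_continuousOn (hcont _ _)).add
      ((hgi _ _).continuousOn_mul (hcont _ _).star)).sub
    (((hgs _ _).mul_continuousOn (hcont _ _)).add
      ((hgi _ _).neg.continuousOn_mul (hcont _ _).star))
  rw [conjTranspose_mul_J_mul_apply, conjTranspose_mul_J_mul_apply, ← Finset.sum_sub_distrib,
    ← intervalIntegral.integral_const_mul]
  have e3 : ∀ j, (star (Z X (.inr j) k) * Z X (.inl j) l - star (Z X (.inl j) k) * Z X (.inr j) l)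
      - (star (Z 0 (.inr j) k) * Z 0 (.inl j) l - star (Z 0 (.inl j) k) * Z 0 (.inr j) l) =
      ∫ t in (0 : ℝ)..X, ((-star (g (.inl j) k t) * Z t (.inl j) l
        + star (Z t (.inr j) k) * g (.inr j) l t) - (star (g (.inr j) k t) * Z t (.inr j) l
        + star (Z t (.inl j) k) * -g (.inl j) l t)) := fun j => by
    rw [intervalIntegral.integral_sub, ← e1, ← e2]
    · ring
    · exact ((hgs _ _).neg.mul_continuousOn (hcont _ _)).add
        ((hgi _ _).continuousOn_mul (hcont _ _).star)
    · exact ((hgs _ _).mul_continuousOn (hcont _ _)).add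
        ((hgi _ _).neg.continuousOn_mul (hcont _ _).star)
  rw [Finset.sum_congr rfl fun j _ => e3 j, ← intervalIntegral.integral_finsetSum
    fun j _ => hint j]
  refine intervalIntegral.integral_congr fun t ht => ?_
  rw [Set.uIcc_of_le hX] at ht
  have hS : (Z t).conjTranspose * (H.S lam t * Z t) - (H.S lam t * Z t).conjTranspose * Z t =
      (lam - starRingEnd ℂ lam) • H.density Z t := by
    rw [Matrix.conjTranspose_mul, H.conjTranspose_S lam ht.1, density, S, S]
    simp only [Matrix.mul_add, Matrix.add_mul, Matrix.mul_smul, Matrix.smul_mul, Matrix.mul_assoc,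
      sub_smul]
    abel
  have hS' := congrFun (congrFun hS k) l
  rw [Matrix.sub_apply, Matrix.smul_apply, smul_eq_mul, Matrix.mul_apply, Matrix.mul_apply,
    Fintype.sum_sum_type, Fintype.sum_sum_type] at hS'
  simp only [Matrix.conjTranspose_apply] at hS'
  refine Eq.trans ?_ hS'
  rw [← Finset.sum_add_distrib, ← Finset.sum_add_distrib, ← Finset.sum_sub_distrib]
  refine Finset.sum_congr rfl fun j _ => ?_
  simp only [hg]
  ring

end HamiltonianSystem

/-! ### The Weyl solutions in the limit-point case -/

/-- The kernel of an `n × 2n` matrix contains an orthonormal `n`-frame. -/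
theorem exists_orthonormal_frame_mul_eq_zero {n : ℕ} (L : Matrix (Fin n) (Fin n ⊕ Fin n) ℂ) :
    ∃ F : Matrix (Fin n ⊕ Fin n) (Fin n) ℂ, F.conjTranspose * F = 1 ∧ L * F = 0 := by
  set T : EuclideanSpace ℂ (Fin n ⊕ Fin n) →ₗ[ℂ] (Fin n → ℂ) :=
    L.mulVecLin ∘ₗ (WithLp.linearEquiv 2 ℂ (Fin n ⊕ Fin n → ℂ)).toLinearMap with hT
  have hdim : n ≤ Module.finrank ℂ (LinearMap.ker T) := by
    have h1 := LinearMap.finrank_range_add_finrank_ker T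
    have h2 := Submodule.finrank_le (LinearMap.range T)
    rw [finrank_euclideanSpace, Fintype.card_sum, Fintype.card_fin] at h1
    rw [Module.finrank_fintype_fun_eq_card, Fintype.card_fin] at h2
    omega
  set b := stdOrthonormalBasis ℂ (LinearMap.ker T) with hb
  refine ⟨Matrix.of fun i j => (b (Fin.castLE hdim j) : EuclideanSpace ℂ (Fin n ⊕ Fin n)) i,
    ?_, ?_⟩
  · ext j k
    have h := b.inner_eq_ite (Fin.castLE hdim j) (Fin.castLE hdim k)
    rw [Submodule.coe_inner, PiLp.inner_apply] at h
    rw [Matrix.mul_apply, Matrix.one_apply]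
    simp only [(Fin.castLE_injective hdim).eq_iff] at h
    rw [← h]
    refine Finset.sum_congr rfl fun i _ => ?_
    simp [mul_comm]
  · ext i j
    have h : L.mulVec (b (Fin.castLE hdim j) : EuclideanSpace ℂ (Fin n ⊕ Fin n)).ofLp = 0 :=
      (b (Fin.castLE hdim j)).2
    exact congrFun h i

/-- Compactness of the set of orthonormal frames: a decreasing sequence of continuous forms, each
nonnegative on the range of some frame, is nonnegative on the range of a common frame. -/
theorem exists_common_orthonormal_frame {m k : Type} [Fintype m] [Fintype k] [DecidableEq k]
    (q : ℕ → (m → ℂ) → ℝ) (hq : ∀ N, Continuous (q N)) (hanti : ∀ N c, q (N + 1) c ≤ q N c)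
    (hne : ∀ N, ∃ F : Matrix m k ℂ, F.conjTranspose * F = 1 ∧ ∀ d, 0 ≤ q N (F.mulVec d)) :
    ∃ F : Matrix m k ℂ, F.conjTranspose * F = 1 ∧ ∀ N d, 0 ≤ q N (F.mulVec d) := by
  set C : ℕ → Set (Matrix m k ℂ) :=
    fun N => {F | F.conjTranspose * F = 1 ∧ ∀ d, 0 ≤ q N (F.mulVec d)} with hC
  have hclosed : ∀ N, IsClosed (C N) := fun N => by
    have h : C N = {F | F.conjTranspose * F = 1} ∩ ⋂ d, {F | 0 ≤ q N (F.mulVec d)} := by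
      ext F; simp [hC]
    rw [h]
    exact (isClosed_eq (by fun_prop) continuous_const).inter (isClosed_iInter fun d =>
      isClosed_le continuous_const ((hq N).comp (by fun_prop)))
  have hbox : IsCompact {F : Matrix m k ℂ | ∀ i j, F i j ∈ Metric.closedBall (0 : ℂ) 1} := by
    have := isCompact_univ_pi fun _ : m => isCompact_univ_pi fun _ : k =>
      isCompact_closedBall (0 : ℂ) 1
    convert! this using 1
    refine Set.ext fun F => ⟨fun h i _ j _ => h i j, fun h i j => h i trivial j trivial⟩
  have hsub : C 0 ⊆ {F : Matrix m k ℂ | ∀ i j, F i j ∈ Metric.closedBall (0 : ℂ) 1} := by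
    intro F hF i j
    have h := congrFun (congrFun hF.1 j) j
    rw [Matrix.mul_apply, Matrix.one_apply_eq] at h
    have h' : ∑ i, ‖F i j‖ ^ 2 = 1 := by
      have : ((∑ i, ‖F i j‖ ^ 2 : ℝ) : ℂ) = 1 := by
        rw [← h]
        push_cast
        refine Finset.sum_congr rfl fun i _ => ?_
        rw [Matrix.conjTranspose_apply, mul_comm]
        exact (Complex.mul_conj' _).symm
      exact_mod_cast this
    have h2 := Finset.single_le_sum (f := fun i => ‖F i j‖ ^ 2) (fun i _ => sq_nonneg _)
      (Finset.mem_univ i)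
    rw [h'] at h2
    simpa using (sq_le_one_iff₀ (norm_nonneg _)).1 h2
  obtain ⟨F, hF⟩ := IsCompact.nonempty_iInter_of_sequence_nonempty_isCompact_isClosed C
    (fun N F hF => ⟨hF.1, fun d => (hF.2 d).trans (hanti N _)⟩) hne
    (hbox.of_isClosed_subset (hclosed 0) hsub) hclosed
  rw [Set.mem_iInter] at hF
  exact ⟨F, (hF 0).1, fun N => (hF N).2⟩

namespace HamiltonianSystem
variable {n : ℕ}

/-- The Hermitian form `w* (iJ) w / 2` of signature `(n, n)`, written out for `w = (u, v)` as
`Im (u* v)`. -/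
def symplecticForm (w : Fin n ⊕ Fin n → ℂ) : ℝ :=
  ∑ j, (star (w (.inl j)) * w (.inr j)).im

theorem continuous_symplecticForm : Continuous (symplecticForm (n := n)) := by
  unfold symplecticForm
  fun_prop

theorem I_mul_conjTranspose_mul_J_mul (Z : Matrix (Fin n ⊕ Fin n) Unit ℂ) :
    (Complex.I * (Z.conjTranspose * Matrix.J (Fin n) ℂ * Z) () ()).re =
      2 * symplecticForm (fun i => Z i ()) := by
  rw [conjTranspose_mul_J_mul_apply, symplecticForm, Finset.mul_sum, Finset.mul_sum,
    Complex.re_sum]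
  refine Finset.sum_congr rfl fun j _ => ?_
  simp
  ring

theorem posSemidef_B_map (H : HamiltonianSystem n) {x : ℝ} (hx : 0 ≤ x) :
    ((H.B x).map Complex.ofReal).PosSemidef := by
  obtain ⟨m, v, hv⟩ := Matrix.posSemidef_iff_eq_sum_vecMulVec.1 (H.posSemidef_B x hx)
  have : (H.B x).map Complex.ofReal =
      ∑ k, Matrix.vecMulVec (fun i => (v k i : ℂ)) (star fun i => (v k i : ℂ)) := by
    ext i j
    simp [hv, Matrix.sum_apply, Matrix.vecMulVec_apply]
  rw [this]
  exact Matrix.posSemidef_sum _ fun k _ => Matrix.posSemidef_vecMulVec_self_star _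

theorem density_nonneg (H : HamiltonianSystem n) (z : ℝ → Matrix (Fin n ⊕ Fin n) Unit ℂ)
    {x : ℝ} (hx : 0 ≤ x) : 0 ≤ H.density z x () () :=
  ((H.posSemidef_B_map hx).conjTranspose_mul_mul_same (z x)).diag_nonneg

theorem IsSolution.intervalIntegrable_density {H : HamiltonianSystem n} {lam : ℂ}
    {z : ℝ → Matrix (Fin n ⊕ Fin n) Unit ℂ} (hz : H.IsSolution lam z) {X : ℝ} (hX : 0 ≤ X) :
    IntervalIntegrable (fun x => H.density z x () ()) volume 0 X := by
  have hB : ∀ i j, IntervalIntegrable (fun x => (H.B x i j : ℂ)) volume 0 X := fun i j => by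
    rw [intervalIntegrable_iff_integrableOn_Icc_of_le hX]
    exact ((H.locallyIntegrable_B i j).integrableOn_compact_subset Set.Icc_subset_Ici_self
      isCompact_Icc).ofReal
  have hcont : ∀ i, ContinuousOn (fun t => z t i ()) (Set.uIcc 0 X) := fun i => by
    rw [Set.uIcc_of_le hX]
    exact (continuousOn_pi.1 (continuousOn_pi.1 hz.1 i) ()).mono Set.Icc_subset_Ici_self
  have hd : (fun x => H.density z x () ()) =
      ∑ i, ∑ j, fun x => star (z x j ()) * (H.B x j i : ℂ) * z x i () := by
    ext x
    simp only [density, Matrix.mul_apply, Finset.sum_mul, Finset.sum_apply]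
    rfl
  rw [hd]
  exact IntervalIntegrable.sum _ fun i _ => IntervalIntegrable.sum _ fun j _ =>
    ((hB j i).continuousOn_mul (hcont j).star).mul_continuousOn (hcont i)

theorem IsSolution.symplecticForm_eq {H : HamiltonianSystem n} {lam : ℂ}
    {z : ℝ → Matrix (Fin n ⊕ Fin n) Unit ℂ} (hz : H.IsSolution lam z) {X : ℝ} (hX : 0 ≤ X) :
    symplecticForm (fun i => z X i ()) = symplecticForm (fun i => z 0 i ()) -
      lam.im * ∫ t in (0 : ℝ)..X, (H.density z t () ()).re := by
  have h := congrArg (fun c => (Complex.I * c).re) (hz.lagrange hX () ())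
  simp only [mul_sub, Complex.sub_re, I_mul_conjTranspose_mul_J_mul] at h
  have h2 : ∫ t in (0 : ℝ)..X, (H.density z t () ()).re =
      (∫ t in (0 : ℝ)..X, H.density z t () ()).re :=
    Complex.reCLM.intervalIntegral_comp_comm (hz.intervalIntegrable_density hX)
  rw [h2]
  simp at h
  linarith

/-- If the symplectic form of a solution keeps the sign of `Im lam`, its initial value bounds the
energy, so the solution is square integrable. -/
theorem IsSolution.squareIntegrable {H : HamiltonianSystem n} {lam : ℂ} (hlam : lam.im ≠ 0)
    {z : ℝ → Matrix (Fin n ⊕ Fin n) Unit ℂ} (hz : H.IsSolution lam z)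
    (hpos : ∀ N : ℕ, 0 ≤ lam.im * symplecticForm (fun i => z N i ())) :
    H.SquareIntegrable z := by
  intro _ _
  rw [integrableOn_Ici_iff_integrableOn_Ioi]
  refine integrableOn_Ioi_of_intervalIntegral_norm_bounded (b := fun N : ℕ => (N : ℝ))
    (l := atTop) (lam.im * symplecticForm (fun i => z 0 i ()) / lam.im ^ 2) 0
    (fun N => ?_) tendsto_natCast_atTop_atTop (Eventually.of_forall fun N => ?_)
  · have := hz.intervalIntegrable_density (Nat.cast_nonneg N)
    rwa [intervalIntegrable_iff_integrableOn_Ioc_of_le (Nat.cast_nonneg N)] at this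
  · have h1 := hpos N
    rw [hz.symplecticForm_eq (Nat.cast_nonneg N)] at h1
    have h2 : ∫ t in (0 : ℝ)..N, ‖H.density z t () ()‖ =
        ∫ t in (0 : ℝ)..N, (H.density z t () ()).re := by
      refine intervalIntegral.integral_congr fun t ht => ?_
      rw [Set.uIcc_of_le (Nat.cast_nonneg N)] at ht
      exact (Complex.re_eq_norm.2 (H.density_nonneg z ht.1)).symm
    rw [h2, le_div_iff₀ (by positivity)]
    linarith

/-- In the limit-point case, `n` linearly independent square integrable solutions span all of them. -/
theorem IsLimitPoint.exists_mulVec_eq {H : HamiltonianSystem n} (hlp : H.IsLimitPoint) {lam : ℂ}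
    (hlam : lam.im ≠ 0) {Z : ℝ → Matrix (Fin n ⊕ Fin n) (Fin n ⊕ Fin n) ℂ}
    (hZ : H.IsSolution lam Z) (hZ0 : Function.Injective (Z 0).mulVec)
    {F : Matrix (Fin n ⊕ Fin n) (Fin n) ℂ} (hF : LinearIndependent ℂ F.col)
    (hFint : ∀ j, H.SquareIntegrable (fun x => Z x * Matrix.replicateCol Unit (F.col j)))
    {v : Fin n ⊕ Fin n → ℂ}
    (hv : H.SquareIntegrable (fun x => Z x * Matrix.replicateCol Unit v)) :
    ∃ d, v = F.mulVec d := by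
  by_contra hcon
  have hnot : v ∉ Submodule.span ℂ (Set.range F.col) := by
    rw [← Matrix.range_mulVecLin]
    rintro ⟨d, hd⟩
    exact hcon ⟨d, hd.symm⟩
  have hli : LinearIndependent ℂ (Fin.cons v F.col : Fin (n + 1) → Fin n ⊕ Fin n → ℂ) :=
    linearIndependent_finCons.2 ⟨hF, hnot⟩
  let T : (Fin n ⊕ Fin n → ℂ) →ₗ[ℂ] (Set.Ici (0 : ℝ) → Matrix (Fin n ⊕ Fin n) Unit ℂ) :=
    { toFun := fun c x => Z x * Matrix.replicateCol Unit c
      map_add' := fun c d => by ext x i k; simp [Matrix.mul_apply, mul_add, Finset.sum_add_distrib]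
      map_smul' := fun a c => by
        ext x i k
        simp [Matrix.mul_apply, Finset.mul_sum, mul_left_comm, mul_add] }
  have hT : LinearMap.ker T = ⊥ := by
    rw [LinearMap.ker_eq_bot]
    intro c d hcd
    apply hZ0
    ext i
    exact congrFun (congrFun (congrFun hcd ⟨0, Set.self_mem_Ici⟩) i) ()
  have hTli := hli.map' T hT
  have hmem := (hlp lam hlam).2 ⟨fun i x =>
    Z x * Matrix.replicateCol Unit ((Fin.cons v F.col : Fin (n + 1) → Fin n ⊕ Fin n → ℂ) i),
    fun i => ⟨hZ.mul_const _, Fin.cases hv hFint i⟩, hTli⟩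
  omega

/-- For a fundamental system `Z` at a non-real `lam`, the symplectic form of the initial value of a
square integrable solution vanishes or has the sign of `Im lam`. -/
theorem IsLimitPoint.symplecticForm_nonneg {H : HamiltonianSystem n} (hlp : H.IsLimitPoint)
    {lam : ℂ} (hlam : lam.im ≠ 0) {Z : ℝ → Matrix (Fin n ⊕ Fin n) (Fin n ⊕ Fin n) ℂ}
    (hZ : H.IsSolution lam Z) (hZ0 : Function.Injective (Z 0).mulVec)
    {V : Matrix (Fin n ⊕ Fin n) (Fin n) ℂ} (hV : H.SquareIntegrable (fun x => Z x * V))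
    (d : Fin n → ℂ) :
    0 ≤ lam.im * symplecticForm ((Z 0).mulVec (V.mulVec d)) := by
  have hform : ∀ c (X : ℝ), 0 ≤ X → symplecticForm ((Z X).mulVec c) =
      symplecticForm ((Z 0).mulVec c) - lam.im * ∫ t in (0 : ℝ)..X,
        (H.density (fun x => Z x * Matrix.replicateCol Unit c) t () ()).re := fun c X hX =>
    (hZ.mul_const (Matrix.replicateCol Unit c)).symplecticForm_eq hX
  obtain ⟨F, hF1, hF⟩ := exists_common_orthonormal_frame (k := Fin n)
    (fun N c => lam.im * symplecticForm ((Z (N : ℝ)).mulVec c))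
    (fun N => continuous_const.mul (continuous_symplecticForm.comp (by fun_prop)))
    (fun N c => by
      have hN : (0 : ℝ) ≤ N := Nat.cast_nonneg N
      have hN1 : (0 : ℝ) ≤ (N + 1 : ℕ) := Nat.cast_nonneg _
      have hz := hZ.mul_const (Matrix.replicateCol Unit c)
      rw [hform c N hN, hform c _ hN1]
      have hmono := intervalIntegral.integral_mono_interval (μ := volume) (c := 0) (a := 0)
        (b := N) (d := (N + 1 : ℕ)) le_rfl hN (by push_cast; linarith)
        (f := fun t => (H.density (fun x => Z x * Matrix.replicateCol Unit c) t () ()).re)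
        ((ae_restrict_iff' measurableSet_Ioc).2 (Eventually.of_forall fun t ht => by
          exact
          (Complex.le_def.1 (H.density_nonneg _ ht.1.le)).1))
        ⟨(hz.intervalIntegrable_density hN1).1.re, (hz.intervalIntegrable_density hN1).2.re⟩
      nlinarith [mul_le_mul_of_nonneg_left hmono (sq_nonneg lam.im)])
    (fun N => by
      -- The form is `≥ 0` on the `n`-dimensional space `v = i (Im lam) u`
      set E : Matrix (Fin n) (Fin n ⊕ Fin n) ℂ :=
        Matrix.fromCols (-(Complex.I * lam.im) • 1) 1 with hE
      obtain ⟨F, hF1, hF2⟩ := exists_orthonormal_frame_mul_eq_zero (E * Z N)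
      refine ⟨F, hF1, fun d => ?_⟩
      set w := (Z (N : ℝ)).mulVec (F.mulVec d) with hw
      have hEw : E.mulVec w = 0 := by
        rw [hw, Matrix.mulVec_mulVec, Matrix.mulVec_mulVec, hF2, Matrix.zero_mulVec]
      have hvu : ∀ j, w (.inr j) = Complex.I * lam.im * w (.inl j) := fun j => by
        have h := congrFun hEw j
        rw [hE, Matrix.fromCols_mulVec] at h
        simp [Matrix.neg_mulVec, Matrix.smul_mulVec] at h
        linear_combination h
      rw [symplecticForm, Finset.mul_sum]
      refine Finset.sum_nonneg fun j _ => ?_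
      rw [hvu j]
      have : (star (w (.inl j)) * (Complex.I * lam.im * w (.inl j))).im =
          lam.im * ((w (.inl j)).re ^ 2 + (w (.inl j)).im ^ 2) := by
        simp
        ring
      rw [this, ← mul_assoc, ← sq]
      positivity)
  have hinj : Function.Injective F.mulVec := fun c d hcd => by
    have := congrArg F.conjTranspose.mulVec hcd
    simpa [Matrix.mulVec_mulVec, hF1] using this
  have hFli : LinearIndependent ℂ F.col := Matrix.mulVec_injective_iff.1 hinj
  have hFint : ∀ j, H.SquareIntegrable (fun x => Z x * Matrix.replicateCol Unit (F.col j)) :=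
    fun j => (hZ.mul_const _).squareIntegrable hlam fun N => by
      have := hF N (Pi.single j 1)
      rwa [Matrix.mulVec_single_one] at this
  have hVF : ∀ j, ∃ d, V.col j = F.mulVec d := fun j =>
    hlp.exists_mulVec_eq hlam hZ hZ0 hFli hFint fun _ _ => hV j j
  choose D hD using hVF
  have hVd : V.mulVec d = F.mulVec (∑ j, d j • D j) := by
    rw [Matrix.mulVec_eq_sum, Matrix.mulVec_sum]
    refine Finset.sum_congr rfl fun j _ => ?_
    rw [Matrix.mulVec_smul, ← hD j]
    ext i
    simp [mul_comm]
  rw [hVd]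
  simpa using hF 0 (∑ j, d j • D j)

/-- A Titchmarsh–Weyl matrix is, up to sign, a matrix Nevanlinna function. -/
theorem IsTitchmarshWeyl.im_mul_im_nonpos {H : HamiltonianSystem n} (hlp : H.IsLimitPoint)
    {M : ℂ → Matrix (Fin n) (Fin n) ℂ} (hM : H.IsTitchmarshWeyl M) {lam : ℂ}
    (hlam : lam.im ≠ 0) (d : Fin n → ℂ) :
    lam.im * (star d ⬝ᵥ (M lam).mulVec d).im ≤ 0 := by
  have hinj : ∀ ZD ZN : ℝ → Matrix (Fin n ⊕ Fin n) (Fin n) ℂ, H.IsDirichletSolution lam ZD →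
      H.IsNeumannSolution lam ZN →
      Function.Injective (Matrix.fromCols (ZN 0) (ZD 0)).mulVec := fun ZD ZN hD hN c e h => by
    rw [hD.2, hN.2] at h
    ext j
    have h1 := congrFun h j
    rcases j with j | j <;>
    simpa [Matrix.fromBlocks_mulVec, Matrix.neg_mulVec, Function.comp] using h1
  rcases hM with hM | hM
  · obtain ⟨ZD, ZN, hD, hN, hsq⟩ := hM lam hlam
    have h := hlp.symplecticForm_nonneg hlam (hN.1.fromCols hD.1) (hinj ZD ZN hD hN)
      (V := Matrix.fromRows 1 (M lam))
      (by simpa only [Matrix.fromCols_mul_fromRows, Matrix.mul_one] using hsq) d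
    rw [hD.2, hN.2] at h
    simp [symplecticForm, Matrix.fromBlocks_mulVec, Matrix.fromRows_mulVec,
      Matrix.neg_mulVec, Function.comp_def] at h
    simp [dotProduct]
    rw [← neg_nonneg, ← mul_neg, ← Finset.sum_neg_distrib]
    convert h using 3
    ring
  · obtain ⟨ZD, ZN, hD, hN, hsq⟩ := hM lam hlam
    have h := hlp.symplecticForm_nonneg hlam (hN.1.fromCols hD.1) (hinj ZD ZN hD hN)
      (V := Matrix.fromRows (-M lam) 1)
      (by simpa only [Matrix.fromCols_mul_fromRows, Matrix.mul_one, Matrix.mul_neg,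
        neg_add_eq_sub] using hsq) d
    rw [hD.2, hN.2] at h
    simp [symplecticForm, Matrix.fromBlocks_mulVec, Matrix.fromRows_mulVec,
      Matrix.neg_mulVec, Function.comp_def] at h
    simp [dotProduct]
    rw [← neg_nonneg, ← mul_neg, ← Finset.sum_neg_distrib]
    convert h using 3
    ring

end HamiltonianSystem

/-! ### Matrix functions with analytic entries -/

/-- All entries of the matrix function `G` are analytic at `z₀`. -/
def MatrixAnalyticAt {m n : Type} (G : ℂ → Matrix m n ℂ) (z₀ : ℂ) : Prop :=
  ∀ i j, AnalyticAt ℂ (fun z => G z i j) z₀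

namespace MatrixAnalyticAt
variable {m n k : Type} {G K : ℂ → Matrix m n ℂ} {z₀ : ℂ}

theorem const (A : Matrix m n ℂ) : MatrixAnalyticAt (fun _ => A) z₀ := fun _ _ => analyticAt_const

theorem add (hG : MatrixAnalyticAt G z₀) (hK : MatrixAnalyticAt K z₀) :
    MatrixAnalyticAt (fun z => G z + K z) z₀ := fun i j => (hG i j).add (hK i j)

theorem smul {f : ℂ → ℂ} (hf : AnalyticAt ℂ f z₀) (hG : MatrixAnalyticAt G z₀) :
    MatrixAnalyticAt (fun z => f z • G z) z₀ := fun i j => hf.mul (hG i j)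

theorem mul [Fintype n] {L : ℂ → Matrix n k ℂ} (hG : MatrixAnalyticAt G z₀)
    (hL : MatrixAnalyticAt L z₀) : MatrixAnalyticAt (fun z => G z * L z) z₀ := fun i j => by
  simp only [Matrix.mul_apply]
  exact Finset.analyticAt_fun_sum _ fun l _ => (hG i l).mul (hL l j)

theorem det [Fintype n] [DecidableEq n] {G : ℂ → Matrix n n ℂ} (hG : MatrixAnalyticAt G z₀) :
    AnalyticAt ℂ (fun z => (G z).det) z₀ := by
  simp only [Matrix.det_apply']
  exact Finset.analyticAt_fun_sum _ fun σ _ =>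
    analyticAt_const.mul (Finset.analyticAt_fun_prod _ fun i _ => hG _ _)

theorem adjugate [Fintype n] [DecidableEq n] {G : ℂ → Matrix n n ℂ}
    (hG : MatrixAnalyticAt G z₀) : MatrixAnalyticAt (fun z => (G z).adjugate) z₀ := fun i j => by
  simp only [Matrix.adjugate_apply]
  refine MatrixAnalyticAt.det fun a b => ?_
  simp only [Matrix.updateRow_apply]
  split_ifs
  · exact analyticAt_const
  · exact hG a b

theorem inv [Fintype n] [DecidableEq n] {G : ℂ → Matrix n n ℂ} (hG : MatrixAnalyticAt G z₀)
    (h0 : (G z₀).det ≠ 0) : MatrixAnalyticAt (fun z => (G z)⁻¹) z₀ := by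
  simp only [Matrix.inv_def, Ring.inverse_eq_inv']
  exact smul (hG.det.inv h0) hG.adjugate

theorem continuousAt (hG : MatrixAnalyticAt G z₀) : ContinuousAt G z₀ :=
  continuousAt_pi.2 fun i => continuousAt_pi.2 fun j => (hG i j).continuousAt

theorem quadForm [Fintype m] [Fintype n] (hG : MatrixAnalyticAt G z₀) (c : m → ℂ) (d : n → ℂ) :
    AnalyticAt ℂ (fun z => c ⬝ᵥ (G z).mulVec d) z₀ := by
  simp only [dotProduct, Matrix.mulVec]
  exact Finset.analyticAt_fun_sum _ fun i _ => analyticAt_const.mul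
    (Finset.analyticAt_fun_sum _ fun j _ => (hG i j).mul analyticAt_const)

theorem eventually_analyticAt [Finite m] [Finite n] (hG : MatrixAnalyticAt G z₀) :
    ∀ᶠ z in 𝓝 z₀, MatrixAnalyticAt G z :=
  eventually_all.2 fun i => eventually_all.2 fun j => (hG i j).eventually_analyticAt

/-- First-order Taylor expansion with analytic remainder. -/
theorem exists_eq_add_smul (hG : MatrixAnalyticAt G 0) :
    ∃ K : ℂ → Matrix m n ℂ, MatrixAnalyticAt K 0 ∧ ∀ z, G z = G 0 + z • K z := by
  refine ⟨fun z => Matrix.of fun i j => dslope (fun z => G z i j) 0 z, fun i j => ?_, fun z => ?_⟩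
  · obtain ⟨p, hp⟩ := hG i j
    exact ⟨_, hp.has_fpower_series_dslope_fslope⟩
  · ext i j
    have := sub_smul_dslope (fun z => G z i j) 0 z
    simp only [sub_zero, smul_eq_mul] at this
    simp [this]

end MatrixAnalyticAt

/-! ### Hermitian matrices and quadratic forms -/

section
variable {n : Type} [Fintype n]

/-- Polarization: over `ℂ` a matrix is determined by its quadratic form. -/
theorem Matrix.eq_zero_of_forall_star_dotProduct [DecidableEq n] {A : Matrix n n ℂ}
    (h : ∀ c, star c ⬝ᵥ A.mulVec c = 0) : A = 0 := by
  have h0 : Matrix.toEuclideanLin A = 0 := (inner_map_self_eq_zero _).1 fun x => by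
    rw [EuclideanSpace.inner_eq_star_dotProduct, Matrix.ofLp_toLpLin, Matrix.toLin'_apply]
    have := congrArg star (h x.ofLp)
    rwa [← star_dotProduct_star, star_star, star_zero, dotProduct_comm] at this
  simpa using h0

theorem Matrix.star_star_dotProduct_mulVec (A : Matrix n n ℂ) (c : n → ℂ) :
    star (star c ⬝ᵥ A.mulVec c) = star c ⬝ᵥ A.conjTranspose.mulVec c := by
  rw [star_dotProduct, star_star, Matrix.dotProduct_mulVec, Matrix.star_mulVec, dotProduct_comm]

theorem Matrix.isHermitian_of_forall_im_eq_zero [DecidableEq n] {A : Matrix n n ℂ}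
    (h : ∀ c, (star c ⬝ᵥ A.mulVec c).im = 0) : A.IsHermitian := by
  have : A.conjTranspose - A = 0 := Matrix.eq_zero_of_forall_star_dotProduct fun c => by
    rw [Matrix.sub_mulVec, dotProduct_sub, ← Matrix.star_star_dotProduct_mulVec, sub_eq_zero]
    exact Complex.conj_eq_iff_im.2 (h c)
  exact sub_eq_zero.1 this

theorem Matrix.IsHermitian.im_star_dotProduct {A : Matrix n n ℂ} (hA : A.IsHermitian)
    (c : n → ℂ) : (star c ⬝ᵥ A.mulVec c).im = 0 := by
  rw [← Complex.conj_eq_iff_im]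
  have := A.star_star_dotProduct_mulVec c
  rwa [hA.eq] at this

/-- The orthogonal projection onto the kernel of a Hermitian matrix. -/
theorem Matrix.IsHermitian.exists_ker_projection [DecidableEq n] {R : Matrix n n ℂ}
    (hR : R.IsHermitian) : ∃ P : Matrix n n ℂ, P.IsHermitian ∧ P * P = P ∧ P * R = 0 ∧
      ∀ x, R.mulVec x = 0 → P.mulVec x = x := by
  set U : Matrix n n ℂ := (hR.eigenvectorUnitary : Matrix n n ℂ) with hU
  have hUU : star U * U = 1 := Unitary.coe_star_mul_self hR.eigenvectorUnitary
  have hUU' : U * star U = 1 := Unitary.coe_mul_star_self hR.eigenvectorUnitary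
  set D : n → ℂ := fun i => (hR.eigenvalues i : ℂ) with hD
  set E : n → ℂ := fun i => if D i = 0 then 1 else 0 with hE
  have hRU : R = U * Matrix.diagonal D * star U := by
    have := hR.spectral_theorem
    rw [Unitary.conjStarAlgAut_apply] at this
    exact this
  have hmul : ∀ A B : Matrix n n ℂ, U * A * star U * (U * B * star U) = U * (A * B) * star U :=
    fun A B => by
      calc U * A * star U * (U * B * star U) = U * A * (star U * U) * B * star U := by
            simp only [Matrix.mul_assoc]
        _ = _ := by rw [hUU, Matrix.mul_one]; simp only [Matrix.mul_assoc]
  refine ⟨U * Matrix.diagonal E * star U, ?_, ?_, ?_, fun x hx => ?_⟩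
  · refine Matrix.isHermitian_mul_mul_conjTranspose U ?_
    refine Matrix.isHermitian_diagonal_of_self_adjoint _ ?_
    ext i
    simp only [hE, Pi.star_apply]
    split_ifs <;> simp
  · rw [hmul, Matrix.diagonal_mul_diagonal]
    congr 3
    ext i
    simp only [hE]
    split_ifs <;> simp
  · rw [hRU, hmul, Matrix.diagonal_mul_diagonal]
    have : (fun i => E i * D i) = 0 := by
      ext i
      simp only [hE]
      split_ifs with h <;> simp [h]
    rw [this, Matrix.diagonal_zero', Matrix.mul_zero, Matrix.zero_mul]
  · have h1 : (Matrix.diagonal D).mulVec ((star U).mulVec x) = 0 := by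
      have := congrArg (star U).mulVec hx
      rwa [hRU, Matrix.mulVec_mulVec, ← Matrix.mul_assoc, ← Matrix.mul_assoc, hUU, Matrix.one_mul,
        Matrix.mulVec_zero, ← Matrix.mulVec_mulVec] at this
    have h2 : (Matrix.diagonal E).mulVec ((star U).mulVec x) = (star U).mulVec x := by
      ext i
      have := congrFun h1 i
      rw [Matrix.mulVec_diagonal] at this ⊢
      simp only [hE]
      split_ifs with h
      · simp
      · simpa [h, eq_comm] using this
    rw [← Matrix.mulVec_mulVec, ← Matrix.mulVec_mulVec, h2, Matrix.mulVec_mulVec, hUU',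
      Matrix.one_mulVec]

end

/-! ### Laurent expansion of a matrix Nevanlinna function at a real point -/

/-- A function with nonnegative imaginary part in the upper half-plane has no pole of order `≥ 2` at
a real point: already the leading coefficient of such a pole would have to vanish. -/
theorem Complex.eq_zero_of_im_div_pow_nonneg {h : ℂ → ℂ} (hh : ContinuousAt h 0) {m : ℕ}
    (hm : 2 ≤ m) (hpos : ∀ᶠ z in 𝓝[≠] (0 : ℂ), 0 < z.im → 0 ≤ (h z / z ^ m).im) : h 0 = 0 := by
  -- Along the ray through `w` the factor `r ^ m > 0` turns the quotient into its leading term.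
  have key : ∀ w : ℂ, 0 < w.im → 0 ≤ (h 0 / w ^ m).im := fun w hw => by
    have hw0 : w ≠ 0 := fun h0 => by simp [h0] at hw
    have ht : Tendsto (fun r : ℝ => (r : ℂ) * w) (𝓝[>] 0) (𝓝[≠] 0) := by
      refine tendsto_nhdsWithin_iff.2 ⟨?_, ?_⟩
      · have : Continuous fun r : ℝ => (r : ℂ) * w := by fun_prop
        have := this.tendsto 0
        simp only [Complex.ofReal_zero, zero_mul] at this
        exact this.mono_left nhdsWithin_le_nhds
      · filter_upwards [self_mem_nhdsWithin] with r hr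
        have : (0 : ℝ) < r := hr
        simp [hw0, this.ne']
    have hlim : Tendsto (fun r : ℝ => (h (r * w) / w ^ m).im) (𝓝[>] 0) (𝓝 (h 0 / w ^ m).im) :=
      (Complex.continuous_im.tendsto _).comp
        ((hh.tendsto.comp (ht.mono_right nhdsWithin_le_nhds)).div_const _)
    refine ge_of_tendsto hlim ?_
    filter_upwards [ht.eventually hpos, self_mem_nhdsWithin] with r hr hr0
    have hr0 : (0 : ℝ) < r := hr0
    have h1 := hr (by simpa using mul_pos hr0 hw)
    have h2 : h (r * w) / w ^ m = ((r ^ m : ℝ) : ℂ) * (h (r * w) / (r * w) ^ m) := by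
      have : (r : ℂ) ≠ 0 := by exact_mod_cast hr0.ne'
      rw [mul_pow]
      push_cast
      field_simp
    rw [h2, Complex.im_ofReal_mul]
    exact mul_nonneg (pow_pos hr0 m).le h1
  -- Four test points in the upper half-plane whose `m`-th powers are `ζ, ζ i, -ζ, -ζ i`;
  -- their arguments are at most `13 π / (8 m) < π` because `m ≥ 2`.
  set ζ : ℂ := Complex.exp (Real.pi / 8 * Complex.I) with hζ
  have hm0 : (0 : ℝ) < m := by positivity
  have key2 : ∀ k : ℕ, k < 4 → 0 ≤ (h 0 / (ζ * Complex.I ^ k)).im := fun k hk => by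
    have hk3 : (k : ℝ) ≤ 3 := by exact_mod_cast Nat.lt_succ_iff.1 hk
    have hm2 : (2 : ℝ) ≤ m := by exact_mod_cast hm
    set θ : ℝ := Real.pi * (1 + 4 * k) / (8 * m) with hθ
    have h1 := key (Complex.exp (θ * Complex.I)) (by
      rw [Complex.exp_ofReal_mul_I_im]
      refine Real.sin_pos_of_pos_of_lt_pi (by positivity) ?_
      rw [hθ, div_lt_iff₀ (by positivity)]
      nlinarith [Real.pi_pos])
    have h2 : Complex.exp (θ * Complex.I) ^ m = ζ * Complex.I ^ k := by
      have hI : Complex.I ^ k = Complex.exp (k * (Real.pi / 2 * Complex.I)) := by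
        rw [Complex.exp_nat_mul, Complex.exp_pi_div_two_mul_I]
      rw [hζ, hI, ← Complex.exp_nat_mul, ← Complex.exp_add]
      congr 1
      have : (m : ℂ) ≠ 0 := by exact_mod_cast hm0.ne'
      rw [hθ]
      push_cast
      field_simp
      ring
    rwa [h2] at h1
  have h0 := key2 0 (by norm_num)
  have h1 := key2 1 (by norm_num)
  have h2 := key2 2 (by norm_num)
  have h3 := key2 3 (by norm_num)
  have hζ0 : ζ ≠ 0 := Complex.exp_ne_zero _
  have e : ∀ k, h 0 / (ζ * Complex.I ^ k) = h 0 / ζ * (-Complex.I) ^ k := fun k => by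
    rw [← Complex.inv_I, inv_pow, div_mul_eq_div_div]
    rfl
  rw [e] at h0 h1 h2 h3
  have e3 : (-Complex.I) ^ 3 = Complex.I := by
    rw [neg_pow, Complex.I_pow_three]; ring
  rw [e3] at h3
  simp at h0 h1 h2 h3
  have : h 0 / ζ = 0 := Complex.ext (by simp; linarith) (by simp; linarith)
  exact (div_eq_zero_iff.1 this).resolve_right hζ0

section
variable {n : Type} [Fintype n] {N : ℂ → Matrix n n ℂ}

/-- A common denominator for the entries of a meromorphic matrix function. The exponent is written as
`m + 1` because the induction that lowers it stops at a simple pole. -/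
theorem exists_matrixAnalyticAt_of_meromorphicAt
    (hN : ∀ i j, MeromorphicAt (fun z => N z i j) 0) :
    ∃ (m : ℕ) (G : ℂ → Matrix n n ℂ), MatrixAnalyticAt G 0 ∧
      ∀ᶠ z in 𝓝[≠] (0 : ℂ), N z = (z ^ (m + 1))⁻¹ • G z := by
  choose k hk using hN
  have hle : ∀ i j, k i j ≤ ∑ i, ∑ j, k i j := fun i j =>
    (Finset.single_le_sum (f := fun j => k i j) (fun _ _ => Nat.zero_le _)
      (Finset.mem_univ j)).trans
    (Finset.single_le_sum (f := fun i => ∑ j, k i j) (fun _ _ => Nat.zero_le _)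
      (Finset.mem_univ i))
  refine ⟨∑ i, ∑ j, k i j, fun z => z ^ (∑ i, ∑ j, k i j + 1) • N z, fun i j => ?_, ?_⟩
  · have h := (analyticAt_id.pow (∑ i, ∑ j, k i j + 1 - k i j)).mul (hk i j)
    refine h.congr (Eventually.of_forall fun z => ?_)
    simp only [Pi.mul_apply, Pi.pow_apply, id_eq, sub_zero, smul_eq_mul, Matrix.smul_apply]
    rw [← mul_assoc, ← pow_add, Nat.sub_add_cancel ((hle i j).trans (Nat.le_succ _))]
  · filter_upwards [self_mem_nhdsWithin] with z hz
    rw [smul_smul, inv_mul_cancel₀ (pow_ne_zero _ hz), one_smul]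

variable [DecidableEq n]

/-- Poles of matrix Nevanlinna functions are at most simple. -/
theorem exists_matrixAnalyticAt_of_nevanlinna
    (hN : ∀ i j, MeromorphicAt (fun z => N z i j) 0)
    (hpos : ∀ᶠ z in 𝓝[≠] (0 : ℂ), 0 < z.im → ∀ c, 0 ≤ (star c ⬝ᵥ N z *ᵥ c).im) :
    ∃ G : ℂ → Matrix n n ℂ, MatrixAnalyticAt G 0 ∧ ∀ᶠ z in 𝓝[≠] (0 : ℂ), N z = z⁻¹ • G z := by
  obtain ⟨m, G, hG, hNG⟩ := exists_matrixAnalyticAt_of_meromorphicAt hN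
  induction m generalizing G with
  | zero => exact ⟨G, hG, by simpa using hNG⟩
  | succ m ih =>
    have h0 : G 0 = 0 := Matrix.eq_zero_of_forall_star_dotProduct fun c =>
      Complex.eq_zero_of_im_div_pow_nonneg (h := fun z => star c ⬝ᵥ G z *ᵥ c) (m := m + 1 + 1)
        (hG.quadForm _ _).continuousAt (by omega) (by
          filter_upwards [hpos, hNG] with z hz hNz him
          have := hz him c
          rwa [hNz, Matrix.smul_mulVec, dotProduct_smul, smul_eq_mul, mul_comm,
            ← div_eq_mul_inv] at this)
    obtain ⟨K, hK, hGK⟩ := hG.exists_eq_add_smul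
    refine ih K hK ?_
    filter_upwards [hNG, self_mem_nhdsWithin] with z hz hz0
    have hz0 : z ≠ 0 := hz0
    rw [hz, hGK, h0, zero_add, smul_smul]
    congr 1
    field_simp
    exact (pow_succ' z (m + 1)).symm

theorem isHermitian_of_eventually_real {n : Type} {G : ℂ → Matrix n n ℂ} (hG : ContinuousAt G 0)
    (h : ∀ᶠ t : ℝ in 𝓝[≠] 0, (G t).IsHermitian) : (G 0).IsHermitian := by
  have ht : Tendsto (fun t : ℝ => G t) (𝓝[≠] 0) (𝓝 (G 0)) :=
    hG.tendsto.comp ((Complex.continuous_ofReal.tendsto' 0 0 rfl).mono_left nhdsWithin_le_nhds)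
  have ht' : Tendsto (fun t : ℝ => (G t)ᴴ) (𝓝[≠] 0) (𝓝 (G 0)ᴴ) :=
    ((continuous_id.matrix_conjTranspose).tendsto (G 0)).comp ht
  exact tendsto_nhds_unique (ht'.congr' (h.mono fun t ht => ht)) ht

theorem tendsto_ofReal_nhdsNE : Tendsto (fun t : ℝ => (t : ℂ)) (𝓝[≠] 0) (𝓝[≠] 0) :=
  tendsto_nhdsWithin_iff.2
    ⟨(Complex.continuous_ofReal.tendsto' 0 0 rfl).mono_left nhdsWithin_le_nhds,
      eventually_nhdsWithin_of_forall fun t ht => by simpa using ht⟩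

/-- A function with the Nevanlinna sign condition has Hermitian values at the real points where it
is continuous: its imaginary part is both `≥ 0` and `≤ 0` there. -/
theorem isHermitian_of_nevanlinna {z : ℂ} (hz : z.im = 0) (hN : ContinuousAt N z)
    (hpos : ∀ᶠ w in 𝓝 z, w.im ≠ 0 → ∀ c, 0 ≤ w.im * (star c ⬝ᵥ N w *ᵥ c).im) :
    (N z).IsHermitian := by
  refine Matrix.isHermitian_of_forall_im_eq_zero fun c => ?_
  have hcont : ContinuousAt (fun w => (star c ⬝ᵥ N w *ᵥ c).im) z :=
    ContinuousAt.comp (g := fun A : Matrix n n ℂ => (star c ⬝ᵥ A *ᵥ c).im)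
      (by fun_prop) hN
  have hpath : ∀ s : ℝ, Tendsto (fun r : ℝ => z + (r * s : ℝ) * Complex.I) (𝓝[>] 0) (𝓝 z) :=
    fun s => by
      have : Continuous fun r : ℝ => z + (r * s : ℝ) * Complex.I := by fun_prop
      exact (this.tendsto' 0 z (by simp)).mono_left nhdsWithin_le_nhds
  have hsign : ∀ s : ℝ, s ≠ 0 → 0 ≤ s * (star c ⬝ᵥ N z *ᵥ c).im := fun s hs => by
    refine ge_of_tendsto (tendsto_const_nhds.mul (hcont.tendsto.comp (hpath s))) ?_
    filter_upwards [(hpath s).eventually hpos, self_mem_nhdsWithin] with r hr hr0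
    have hr0 : (0 : ℝ) < r := hr0
    have him : (z + (r * s : ℝ) * Complex.I).im = r * s := by simp [hz]
    have := hr (by rw [him]; exact mul_ne_zero hr0.ne' hs) c
    rw [him, mul_assoc] at this
    exact nonneg_of_mul_nonneg_right this hr0
  have h1 := hsign 1 one_ne_zero
  have h2 := hsign (-1) (by norm_num)
  linarith

/-- Laurent expansion of a matrix Nevanlinna function at a pole on the real axis: the pole is
simple, and the residue and the constant term are Hermitian. -/
theorem exists_laurent_of_nevanlinna (hN : ∀ i j, MeromorphicAt (fun z => N z i j) 0)
    (hpos : ∀ᶠ z in 𝓝[≠] (0 : ℂ), z.im ≠ 0 → ∀ c, 0 ≤ z.im * (star c ⬝ᵥ N z *ᵥ c).im) :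
    ∃ (R : Matrix n n ℂ) (K : ℂ → Matrix n n ℂ), R.IsHermitian ∧ (K 0).IsHermitian ∧
      MatrixAnalyticAt K 0 ∧ ∀ᶠ z in 𝓝[≠] (0 : ℂ), N z = z⁻¹ • R + K z := by
  obtain ⟨G, hG, hNG⟩ := exists_matrixAnalyticAt_of_nevanlinna hN
    (hpos.mono fun z hz him c => nonneg_of_mul_nonneg_right (hz him.ne' c) him)
  obtain ⟨K, hK, hGK⟩ := hG.exists_eq_add_smul
  have hherm : ∀ᶠ z in 𝓝[≠] (0 : ℂ), z.im = 0 → (G z).IsHermitian := by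
    filter_upwards [eventually_eventually_nhdsWithin.2 hNG, eventually_eventually_nhdsWithin.2 hpos,
      self_mem_nhdsWithin, nhdsWithin_le_nhds hG.eventually_analyticAt, hNG]
      with z hz1 hz2 hz0 hGz hNz him
    have hz0 : z ≠ 0 := hz0
    rw [isOpen_compl_singleton.nhdsWithin_eq hz0] at hz1 hz2
    have hc : ContinuousAt (fun w => w⁻¹ • G w) z :=
      (continuousAt_inv₀ hz0).smul hGz.continuousAt
    have h1 := isHermitian_of_nevanlinna him (hc.congr (hz1.mono fun w hw => hw.symm)) hz2
    have h2 : G z = z • N z := by rw [hNz, smul_smul, mul_inv_cancel₀ hz0, one_smul]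
    rw [h2, Matrix.IsHermitian, Matrix.conjTranspose_smul, h1.eq]
    congr 1
    exact Complex.conj_eq_iff_im.2 him
  have hGt := tendsto_ofReal_nhdsNE.eventually hherm
  have hG0 : (G 0).IsHermitian := isHermitian_of_eventually_real hG.continuousAt
    (hGt.mono fun t ht => ht (Complex.ofReal_im t))
  refine ⟨G 0, K, hG0, isHermitian_of_eventually_real hK.continuousAt ?_, hK, ?_⟩
  · filter_upwards [hGt, self_mem_nhdsWithin] with t ht ht0
    have ht0 : (t : ℂ) ≠ 0 := by simpa using ht0
    have h1 : K t = ((t⁻¹ : ℝ) : ℂ) • (G t - G 0) := by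
      rw [hGK t, add_sub_cancel_left, smul_smul]
      push_cast
      rw [inv_mul_cancel₀ ht0, one_smul]
    rw [h1, Matrix.IsHermitian, Matrix.conjTranspose_smul,
      ((ht (Complex.ofReal_im t)).sub hG0).eq]
    simp
  · filter_upwards [hNG, self_mem_nhdsWithin] with z hz hz0
    have hz0 : z ≠ 0 := hz0
    rw [hz, hGK z, smul_add, smul_smul, inv_mul_cancel₀ hz0, one_smul]

end

/-! ### Removable singularities of the shifted inverse -/

section
variable {n : Type} [Fintype n] [DecidableEq n] {N K : ℂ → Matrix n n ℂ} {R P : Matrix n n ℂ}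
  {α : ℂ}

/-- Multiplying `α + R / z + K(z)` from the left by `z (1 - P) + P`, where `P` projects onto
`ker R`, removes the pole and leaves `R + P (α + K(0))` at `z = 0`. If the latter is invertible,
then the inverse of `α + R / z + K(z)` is analytic at `0`. -/
theorem exists_inv_analytic_of_det_ne_zero (hPR : P * R = 0)
    (hK : MatrixAnalyticAt K 0) (hN : ∀ᶠ z in 𝓝[≠] (0 : ℂ), N z = z⁻¹ • R + K z)
    (hdet : (R + (α • P + P * K 0)).det ≠ 0) :
    (∀ᶠ z in 𝓝[≠] (0 : ℂ), IsUnit (α • (1 : Matrix n n ℂ) + N z)) ∧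
    ∃ G : ℂ → Matrix n n ℂ, MatrixAnalyticAt G 0 ∧
      ∀ᶠ z in 𝓝[≠] (0 : ℂ), (α • (1 : Matrix n n ℂ) + N z)⁻¹ = G z := by
  set T : ℂ → Matrix n n ℂ := fun z =>
    (R + (α • P + P * K z)) + z • ((1 - P) * (α • 1 + K z)) with hT
  have hTa : MatrixAnalyticAt T 0 :=
    (((MatrixAnalyticAt.const R).add ((MatrixAnalyticAt.const (α • P)).add
      ((MatrixAnalyticAt.const P).mul hK)))).add
      (MatrixAnalyticAt.smul analyticAt_id ((MatrixAnalyticAt.const (1 - P)).mul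
        ((MatrixAnalyticAt.const (α • 1)).add hK)))
  have hT0 : (T 0).det ≠ 0 := by simpa [hT] using hdet
  have hleft : ∀ᶠ z in 𝓝[≠] (0 : ℂ),
      (T z)⁻¹ * (z • (1 - P) + P) * (α • (1 : Matrix n n ℂ) + N z) = 1 := by
    filter_upwards [hN, self_mem_nhdsWithin,
      nhdsWithin_le_nhds (hTa.det.continuousAt.eventually_ne hT0)] with z hz hz0 hdz
    have hz0 : z ≠ 0 := hz0
    have h1 : (z • (1 - P) + P) * (α • (1 : Matrix n n ℂ) + N z) = T z := by
      have h2 : (1 - P) * R = R := by rw [Matrix.sub_mul, hPR, Matrix.one_mul, sub_zero]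
      have h3 : z • ((1 - P) * (z⁻¹ • R)) = R := by
        rw [Matrix.mul_smul, h2, smul_smul, mul_inv_cancel₀ hz0, one_smul]
      have h4 : P * (z⁻¹ • R) = 0 := by rw [Matrix.mul_smul, hPR, smul_zero]
      rw [hz, hT, Matrix.add_mul, Matrix.smul_mul]
      simp only [Matrix.mul_add, smul_add, h3, h4]
      rw [Matrix.mul_smul P, Matrix.mul_one]
      abel
    rw [Matrix.mul_assoc, h1, Matrix.nonsing_inv_mul _ (isUnit_iff_ne_zero.2 hdz)]
  refine ⟨hleft.mono fun z hz => IsUnit.of_mul_eq_one_right _ hz,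
    fun z => (T z)⁻¹ * (z • (1 - P) + P), ?_, hleft.mono fun z hz => Matrix.inv_eq_left_inv hz⟩
  exact (hTa.inv hT0).mul ((MatrixAnalyticAt.smul analyticAt_id (MatrixAnalyticAt.const _)).add
    (MatrixAnalyticAt.const _))

/-- A null vector of `R + P (α + K)` lies in `ker R` and is isotropic for `α + K`. -/
theorem isotropic_of_mulVec_eq_zero {n : Type} [Fintype n] {R P K : Matrix n n ℂ} {α : ℂ}
    (hPh : P.IsHermitian) (hPP : P * P = P)
    (hPR : P * R = 0) (hker : ∀ x, R *ᵥ x = 0 → P *ᵥ x = x) {x : n → ℂ}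
    (hx : (R + (α • P + P * K)) *ᵥ x = 0) :
    R *ᵥ x = 0 ∧ α * (star x ⬝ᵥ x) + star x ⬝ᵥ K *ᵥ x = 0 := by
  have h1 : (α • P + P * K) *ᵥ x = 0 := by
    have h := congrArg P.mulVec hx
    rwa [Matrix.mulVec_mulVec, Matrix.mul_add, hPR, zero_add, Matrix.mul_add, Matrix.mul_smul,
      ← Matrix.mul_assoc, hPP, Matrix.mulVec_zero] at h
  have h2 : R *ᵥ x = 0 := by rwa [Matrix.add_mulVec, h1, add_zero] at hx
  refine ⟨h2, ?_⟩
  have h3 : star x ᵥ* P = star x := by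
    have := congrArg star (hker x h2)
    rwa [Matrix.star_mulVec, hPh.eq] at this
  have h4 := congrArg (star x ⬝ᵥ ·) h1
  simp only [dotProduct_zero] at h4
  rwa [Matrix.add_mulVec, dotProduct_add, Matrix.smul_mulVec, dotProduct_smul,
    ← Matrix.mulVec_mulVec, Matrix.dotProduct_mulVec, Matrix.dotProduct_mulVec, h3,
    smul_eq_mul] at h4

theorem det_ne_zero_of_im_ne_zero {K : Matrix n n ℂ} (hPh : P.IsHermitian) (hPP : P * P = P)
    (hPR : P * R = 0) (hker : ∀ x, R *ᵥ x = 0 → P *ᵥ x = x) (hK : K.IsHermitian)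
    (hα : α.im ≠ 0) : (R + (α • P + P * K)).det ≠ 0 := by
  intro hdet
  obtain ⟨x, hx0, hx⟩ := Matrix.exists_mulVec_eq_zero_iff.2 hdet
  have h := congrArg Complex.im (isotropic_of_mulVec_eq_zero hPh hPP hPR hker hx).2
  have hxx : (star x ⬝ᵥ x).im = 0 := by
    simpa using (Matrix.isHermitian_one (n := n) (α := ℂ)).im_star_dotProduct x
  rw [Complex.add_im, hK.im_star_dotProduct, Complex.mul_im, hxx, mul_zero, zero_add, add_zero,
    Complex.zero_im] at h
  have h0 : star x ⬝ᵥ x = 0 := Complex.ext ((mul_eq_zero.1 h).resolve_left hα) hxx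
  exact hx0 (dotProduct_star_self_eq_zero.1 h0)

/-- A pencil `A + a P` that is invertible for one `a` is singular for finitely many `a` only. -/
theorem finite_setOf_det_add_smul_eq_zero (A P : Matrix n n ℂ) {α : ℂ}
    (hα : (A + α • P).det ≠ 0) : {a : ℂ | (A + a • P).det = 0}.Finite := by
  set p : Polynomial ℂ :=
    (A.map Polynomial.C + (Polynomial.X : Polynomial ℂ) • P.map Polynomial.C).det with hp
  have heval : ∀ a, p.eval a = (A + a • P).det := fun a => by
    rw [hp, ← Polynomial.coe_evalRingHom, RingHom.map_det]
    congr 1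
    ext i j
    simpa using mul_comm (P i j) a
  have hp0 : p ≠ 0 := fun h => hα (by rw [← heval, h, Polynomial.eval_zero])
  refine (p.rootSet_finite ℂ).subset fun a ha => ?_
  rw [Polynomial.mem_rootSet]
  exact ⟨hp0, by rw [Polynomial.coe_aeval_eq_eval, heval]; exact ha⟩

end

/-- Two vectors in the kernel of a nonzero `2 × 2` matrix are proportional. -/
theorem exists_eq_smul_of_mulVec_eq_zero {R : Matrix (Fin 2) (Fin 2) ℂ} (hR : R ≠ 0)
    {x y : Fin 2 → ℂ} (hx : R *ᵥ x = 0) (hy : R *ᵥ y = 0) (hy0 : y ≠ 0) : ∃ c : ℂ, x = c • y := by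
  by_contra hcon
  have hli : LinearIndependent ℂ ![y, x] :=
    (LinearIndependent.pair_iff' hy0).2 fun a ha => hcon ⟨a, ha.symm⟩
  set W : Matrix (Fin 2) (Fin 2) ℂ := Matrix.of ![y, x] with hW
  have hWu : IsUnit W := Matrix.linearIndependent_rows_iff_isUnit.1 hli
  have hRW : R * Wᵀ = 0 := by
    ext i j
    fin_cases j
    · exact congrFun hy i
    · exact congrFun hx i
  apply hR
  exact (((Matrix.isUnit_transpose _).2 hWu).mul_left_eq_zero).1 hRW

theorem MatrixHasPoleAt.not_eventuallyEq {n : ℕ} {F G : ℂ → Matrix (Fin n) (Fin n) ℂ}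
    (hF : MatrixHasPoleAt F 0) (hG : MatrixAnalyticAt G 0) : ¬ ∀ᶠ z in 𝓝[≠] (0 : ℂ), F z = G z := by
  intro h
  obtain ⟨i, j, hij⟩ := hF.2
  have h1 : (fun z => F z i j) =ᶠ[𝓝[≠] 0] fun z => G z i j := h.mono fun z hz => by
    simp only [hz]
  rw [meromorphicOrderAt_congr h1] at hij
  exact not_lt.2 (hG i j).meromorphicOrderAt_nonneg hij

/-- If `M` is singular near `0`, then `M⁻¹` is identically zero there by convention, hence has no
pole. -/
theorem MatrixHasPoleAt.eventually_isUnit {n : ℕ} {M : ℂ → Matrix (Fin n) (Fin n) ℂ}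
    (hM : ∀ i j, MeromorphicAt (fun z => M z i j) 0)
    (hinv : MatrixHasPoleAt (fun z => (M z)⁻¹) 0) : ∀ᶠ z in 𝓝[≠] (0 : ℂ), IsUnit (M z) := by
  have hdet : MeromorphicAt (fun z => (M z).det) 0 := by
    simp only [Matrix.det_apply']
    exact MeromorphicAt.fun_sum fun σ _ =>
      (MeromorphicAt.const _ 0).fun_mul (MeromorphicAt.fun_prod fun i _ => hM _ _)
  rcases hdet.eventually_eq_zero_or_eventually_ne_zero with h | h
  · refine absurd ?_ (hinv.not_eventuallyEq (MatrixAnalyticAt.const 0))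
    filter_upwards [h] with z hz
    exact Matrix.nonsing_inv_apply_not_isUnit _ (by simp [hz])
  · filter_upwards [h] with z hz
    exact (Matrix.isUnit_iff_isUnit_det _).2 (isUnit_iff_ne_zero.2 hz)

theorem mainTheorem2 (n : ℕ) (H : HamiltonianSystem n)
    (hdef : H.IsDefinite) (hlp : H.IsLimitPoint)
    (M : ℂ → Matrix (Fin n) (Fin n) ℂ) (hM : H.IsTitchmarshWeyl M)
    (hpole : MatrixHasPoleAt M 0)
    (hpole_inv : MatrixHasPoleAt (fun lam => (M lam)⁻¹) 0) :
    (∀ α : ℂ, α.im ≠ 0 → PsiRemovableAtZero M α) ∧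
    {a : ℝ | ¬ PsiRemovableAtZero M (a : ℂ)}.Finite ∧
    (n = 2 → ∀ α : ℂ, α ≠ 0 → PsiRemovableAtZero M α) := by
  have hunit := MatrixHasPoleAt.eventually_isUnit hpole.1 hpole_inv
  have hsign : ∀ᶠ z in 𝓝[≠] (0 : ℂ), z.im ≠ 0 →
      ∀ c, 0 ≤ z.im * (star c ⬝ᵥ (M z)⁻¹ *ᵥ c).im := by
    filter_upwards [hunit] with z hz him c
    have h := hM.im_mul_im_nonpos hlp him ((M z)⁻¹ *ᵥ c)
    rw [Matrix.mulVec_mulVec, Matrix.mul_nonsing_inv _ ((Matrix.isUnit_iff_isUnit_det _).1 hz),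
      Matrix.one_mulVec] at h
    have hconj : star ((M z)⁻¹ *ᵥ c) ⬝ᵥ c = star (star c ⬝ᵥ (M z)⁻¹ *ᵥ c) := Matrix.star_dotProduct _ _
    rw [hconj] at h
    have him' : (star (star c ⬝ᵥ (M z)⁻¹ *ᵥ c)).im = -(star c ⬝ᵥ (M z)⁻¹ *ᵥ c).im :=
      Complex.conj_im _
    rw [him'] at h
    linarith
  obtain ⟨R, K, hR, hK0, hK, hN⟩ := exists_laurent_of_nevanlinna hpole_inv.1 hsign
  obtain ⟨P, hPh, hPP, hPR, hker⟩ := hR.exists_ker_projection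
  have hcrit : ∀ α : ℂ, (R + (α • P + P * K 0)).det ≠ 0 → PsiRemovableAtZero M α := fun α hα => by
    obtain ⟨h1, G, hG, h2⟩ := exists_inv_analytic_of_det_ne_zero hPR hK hN hα
    exact ⟨hunit.and h1, G, hG, h2⟩
  have hnonreal : ∀ α : ℂ, α.im ≠ 0 → (R + (α • P + P * K 0)).det ≠ 0 := fun α hα =>
    det_ne_zero_of_im_ne_zero hPh hPP hPR hker hK0 hα
  refine ⟨fun α hα => hcrit α (hnonreal α hα), ?_, ?_⟩
  · have hform : ∀ α : ℂ, R + (α • P + P * K 0) = (R + P * K 0) + α • P := fun α => by abel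
    have hfin := finite_setOf_det_add_smul_eq_zero (R + P * K 0) P (α := Complex.I) (by
      rw [← hform]; exact hnonreal _ (by simp))
    refine (hfin.preimage Complex.ofReal_injective.injOn).subset fun a ha => ?_
    by_contra hcon
    refine ha (hcrit a ?_)
    rw [hform]
    exact hcon
  · rintro rfl α hα
    refine hcrit α fun hdet => ?_
    have hR0 : R ≠ 0 := fun h => hpole_inv.not_eventuallyEq hK (by simpa [h] using hN)
    -- Since `M = (0 + M⁻¹)⁻¹` has a pole, the criterion fails at `0`: the form of `K 0` vanishes
    -- on the line `ker R`.
    have hdet0 : (R + ((0 : ℂ) • P + P * K 0)).det = 0 := by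
      by_contra h
      obtain ⟨-, G, hG, h2⟩ := exists_inv_analytic_of_det_ne_zero hPR hK hN h
      refine hpole.not_eventuallyEq hG ?_
      filter_upwards [h2, hunit] with z hz hu
      rw [← hz, zero_smul, zero_add,
        Matrix.nonsing_inv_nonsing_inv _ ((Matrix.isUnit_iff_isUnit_det _).1 hu)]
    obtain ⟨y, hy0, hy⟩ := Matrix.exists_mulVec_eq_zero_iff.2 hdet0
    obtain ⟨x, hx0, hx⟩ := Matrix.exists_mulVec_eq_zero_iff.2 hdet
    obtain ⟨hRy, hKy⟩ := isotropic_of_mulVec_eq_zero hPh hPP hPR hker hy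
    obtain ⟨hRx, hKx⟩ := isotropic_of_mulVec_eq_zero hPh hPP hPR hker hx
    obtain ⟨c, rfl⟩ := exists_eq_smul_of_mulVec_eq_zero hR0 hRx hRy hy0
    rw [zero_mul, zero_add] at hKy
    have hKc : star (c • y) ⬝ᵥ K 0 *ᵥ (c • y) = 0 := by
      rw [Matrix.mulVec_smul, dotProduct_smul, star_smul, smul_dotProduct, hKy, smul_zero, smul_zero]
    rw [hKc, add_zero] at hKx
    exact hx0 (dotProduct_star_self_eq_zero.1 ((mul_eq_zero.1 hKx).resolve_left hα))
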